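/- **Theorem 2.2.** Let $\mathcal K\ge 1$ and let $\boldsymbol\ell=(\ell_1,\dots,\ell_{\mathcal K})$ be a vector of positive integers; put $R=\sum_{j=1}^{\mathcal K}\ell_j+\mathcal K$. For an integer $N\ge R$ let $\mathcal P_N:\mathbb C^R\to\mathbb C^N$ be the map that sends $$x=(a_{0,1},\dots,a_{\ell_1-1,1},z_1,\;\dots,\;a_{0,\mathcal K},\dots,a_{\ell_{\mathcal K}-1,\mathcal K},z_{\mathcal K})$$ to $(m_0,\dots,m_{N-1})$, where $$m_k=\sum_{j=1}^{\mathcal K}z_j^k\sum_{\ell=0}^{\ell_j-1}a_{\ell,j}k^\ell\qquad(0^0=1),$$ and let $\mathcal J_N(x)\in\mathbb C^{N\times R}$ be its Jacobian matrix at $x$. For a parameter $\alpha$ (one of the $a_{\ell,j}$, $z_j$), let $$CN_{\alpha,N}(x)=\sum_{i=1}^N\bigl|(\mathcal J_N(x)^\dagger)_{\alpha,i}\bigr|,$$ where $\dagger$ denotes the Moore–Penrose pseudo-inverse. For $x$ with $|z_1|=\dots=|z_{\mathcal K}|=1$ let $\delta(x)=\min_{r\ne s}|\arg z_r-\arg z_s|$,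 where the angular differences are taken modulo $2\pi$ so as to lie in $[0,\pi]$; if $\mathcal K=1$, put $\delta(x)=\infty$ and $\delta(x)^{-1}=0$. Put $a_{-1,j}=0$. Consider points $x\in\mathbb C^R$ such that $|z_j|=1$ and $a_{\ell_j-1,j}\neq 0$ for all $j$, and $\delta=\delta(x)>0$. 1. For every such $x$ and every $N\ge R$, the matrix $\mathcal J_N(x)$ has full rank, i.e. rank $R$. 2. There exist constants $K$, $C^{(3)}$, $C^{(4)}$, depending only on $\boldsymbol\ell$ (in particular not on $N$, $\delta$ or $x$), such that for every such $x$ and every $N\ge R$ with $N>K\,\delta^{-1}$, $$CN_{a_{\ell,j},N}(x)\le C^{(3)}\Bigl(1+\frac{|a_{\ell-1,j}|}{|a_{\ell_j-1,j}|}\Bigr)\frac1{N^{\ell}}\qquad(1\le j\le\mathcal K,\ 0\le\ell\le\ell_j-1),$$ $$CN_{z_j,N}(x)\le C^{(4)}\,\frac{1}{|a_{\ell_j-1,j}|}\,\frac1{N^{\ell_j}}\qquad(1\le j\le\mathcal K).$$ -/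

import Mathlib

open scoped Matrix ENNReal NNReal ComplexConjugate

noncomputable section

namespace Prony

section MoorePenrose

open scoped ComplexOrder

variable {m n : Type*} [Fintype m] [Fintype n]

/-- The four Penrose equations: `P` is a Moore-Penrose pseudo-inverse of `A`. -/
structure IsMoorePenrose (A : Matrix m n ℂ) (P : Matrix n m ℂ) : Prop where
  mul_mul_self : A * P * A = A
  self_mul_mul : P * A * P = P
  left_hermitian : (A * P)ᴴ = A * P
  right_hermitian : (P * A)ᴴ = P * A

/-- The Moore-Penrose pseudo-inverse is unique. -/
theorem IsMoorePenrose.unique {A : Matrix m n ℂ} {P Q : Matrix n m ℂ}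
    (hP : IsMoorePenrose A P) (hQ : IsMoorePenrose A Q) : P = Q := by
  have h1 : A * P = A * Q := by
    calc A * P = (A * P)ᴴ := hP.left_hermitian.symm
      _ = ((A * Q) * (A * P))ᴴ := by rw [← Matrix.mul_assoc, hQ.mul_mul_self]
      _ = (A * P) * (A * Q) := by
        rw [Matrix.conjTranspose_mul, hP.left_hermitian, hQ.left_hermitian]
      _ = A * Q := by rw [← Matrix.mul_assoc, hP.mul_mul_self]
  have h2 : P * A = Q * A := by
    calc P * A = (P * A)ᴴ := hP.right_hermitian.symm
      _ = ((P * A) * (Q * A))ᴴ := by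
        rw [Matrix.mul_assoc, ← Matrix.mul_assoc A, hQ.mul_mul_self]
      _ = (Q * A) * (P * A) := by
        rw [Matrix.conjTranspose_mul, hP.right_hermitian, hQ.right_hermitian]
      _ = Q * A := by rw [Matrix.mul_assoc, ← Matrix.mul_assoc A, hP.mul_mul_self]
  calc P = P * A * P := hP.self_mul_mul.symm
    _ = Q * (A * P) := by rw [h2, Matrix.mul_assoc]
    _ = Q * A * Q := by rw [h1, Matrix.mul_assoc]
    _ = Q := hQ.self_mul_mul

/-- Every complex matrix has a Moore-Penrose pseudo-inverse. -/
theorem exists_isMoorePenrose (A : Matrix m n ℂ) : ∃ P, IsMoorePenrose A P := by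
  classical
  have hH : (Aᴴ * A).IsHermitian := Matrix.isHermitian_conjTranspose_mul_self A
  obtain ⟨G, hG, hHGH, hGHG, hGH⟩ : ∃ G : Matrix n n ℂ, Gᴴ = G ∧
      (Aᴴ * A) * (G * (Aᴴ * A)) = Aᴴ * A ∧ G * (Aᴴ * A) * G = G ∧
      (G * (Aᴴ * A))ᴴ = G * (Aᴴ * A) := by
    set U : Matrix n n ℂ := (hH.eigenvectorUnitary : Matrix n n ℂ) with hU
    have hUU : Uᴴ * U = 1 := Unitary.coe_star_mul_self hH.eigenvectorUnitary
    set d : n → ℂ := fun i => ((hH.eigenvalues i : ℝ) : ℂ) with hd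
    have hs : Aᴴ * A = U * Matrix.diagonal d * Uᴴ := by
      have := hH.spectral_theorem
      simpa [Unitary.conjStarAlgAut_apply, Matrix.star_eq_conjTranspose, hd, hU,
        Function.comp_def] using this
    have hc : ∀ a b : n → ℂ, (U * Matrix.diagonal a * Uᴴ) * (U * Matrix.diagonal b * Uᴴ)
        = U * Matrix.diagonal (fun i => a i * b i) * Uᴴ := by
      intro a b
      calc _ = U * Matrix.diagonal a * (Uᴴ * U) * Matrix.diagonal b * Uᴴ := by
            simp only [Matrix.mul_assoc]
        _ = _ := by
          rw [hUU, Matrix.mul_one, Matrix.mul_assoc U, Matrix.diagonal_mul_diagonal]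
    have hr : ∀ a : n → ℂ, (∀ i, conj (a i) = a i) →
        (U * Matrix.diagonal a * Uᴴ)ᴴ = U * Matrix.diagonal a * Uᴴ := by
      intro a ha
      have : star a = a := funext ha
      simp [Matrix.conjTranspose_mul, Matrix.diagonal_conjTranspose, this, Matrix.mul_assoc]
    refine ⟨U * Matrix.diagonal (fun i => (d i)⁻¹) * Uᴴ, hr _ ?_, ?_, ?_, ?_⟩
    · intro i; simp [hd]
    · rw [hs, hc, hc]; congr 3; funext i
      by_cases h : d i = 0 <;> simp [h]
    · rw [hs, hc, hc]; congr 3; funext i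
      by_cases h : d i = 0 <;> simp [h]
    · rw [hs, hc]; apply hr; intro i; simp [hd]
  have hA : A * (G * (Aᴴ * A)) = A := by
    have h0 : (Aᴴ * A) * (G * (Aᴴ * A) - 1) = 0 := by
      rw [Matrix.mul_sub, hHGH, Matrix.mul_one, sub_self]
    have h1 := (Matrix.conjTranspose_mul_self_mul_eq_zero A _).1 h0
    rwa [Matrix.mul_sub, Matrix.mul_one, sub_eq_zero] at h1
  refine ⟨G * Aᴴ, ?_, ?_, ?_, ?_⟩
  · simpa only [Matrix.mul_assoc] using hA
  · calc G * Aᴴ * A * (G * Aᴴ) = G * (Aᴴ * A) * G * Aᴴ := by simp only [Matrix.mul_assoc]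
      _ = G * Aᴴ := by rw [hGHG]
  · simp only [Matrix.conjTranspose_mul, Matrix.conjTranspose_conjTranspose, hG,
      Matrix.mul_assoc]
  · rw [Matrix.mul_assoc]; exact hGH

/-- The Moore-Penrose pseudo-inverse `A†` of a complex matrix. -/
def pinv (A : Matrix m n ℂ) : Matrix n m ℂ := Classical.choose (exists_isMoorePenrose A)

theorem pinv_spec (A : Matrix m n ℂ) : IsMoorePenrose A (pinv A) :=
  Classical.choose_spec (exists_isMoorePenrose A)

end MoorePenrose

/-- Positions of the parameters, for the structure vector `ℓ = (ℓ₁, …, ℓ_𝒦)`: the block of the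
`j`-th node has `ℓ j + 1` positions, `0, …, ℓ j - 1` for the coefficients `a_{0,j}, …,
a_{ℓ_j - 1, j}` and the last one for the node `z_j`. -/
abbrev ParamIdx {𝒦 : ℕ} (ℓ : Fin 𝒦 → ℕ) : Type := (j : Fin 𝒦) × Fin (ℓ j + 1)

/-- The number `R = ∑ ℓ_j + 𝒦` of unknown parameters. -/
def numParams {𝒦 : ℕ} (ℓ : Fin 𝒦 → ℕ) : ℕ := ∑ j, ℓ j + 𝒦

/-- The parameter vectors, `ℂ^R`. -/
abbrev Params {𝒦 : ℕ} (ℓ : Fin 𝒦 → ℕ) : Type := ParamIdx ℓ → ℂ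

variable {𝒦 : ℕ} {ℓ : Fin 𝒦 → ℕ}

/-- The position of the coefficient `a_{i,j}`, for `0 ≤ i < ℓ_j`. -/
def coeffIdx (j : Fin 𝒦) (i : Fin (ℓ j)) : ParamIdx ℓ := ⟨j, i.castSucc⟩

/-- The position of the node `z_j`. -/
def nodeIdx (j : Fin 𝒦) : ParamIdx ℓ := ⟨j, Fin.last (ℓ j)⟩

/-- The node `z_j`. -/
def node (x : Params ℓ) (j : Fin 𝒦) : ℂ := x (nodeIdx j)

/-- The coefficient `a_{i,j}` for an integer index `i`; it is `0` outside `0 ≤ i < ℓ_j`, in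
particular `a_{-1,j} = 0`. -/
def coeff (x : Params ℓ) (j : Fin 𝒦) (i : ℤ) : ℂ :=
  if h : 0 ≤ i ∧ i < (ℓ j : ℤ) then x (coeffIdx j ⟨i.toNat, by omega⟩) else 0

/-- The forward map `ℂ^R → ℂ^N`, `m_k = ∑_j z_j^k ∑_{i < ℓ_j} a_{i,j} k^i` for
`k = 0, …, N - 1` (with `0 ^ 0 = 1`). -/
def forwardMap (ℓ : Fin 𝒦 → ℕ) (N : ℕ) (x : Params ℓ) : Fin N → ℂ := fun k =>
  ∑ j, node x j ^ (k : ℕ) * ∑ i : Fin (ℓ j), x (coeffIdx j i) * ((k : ℕ) : ℂ) ^ (i : ℕ)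

/-- The `N × R` Jacobian matrix of the forward map at `x`. -/
def jacobian (N : ℕ) (x : Params ℓ) : Matrix (Fin N) (ParamIdx ℓ) ℂ :=
  LinearMap.toMatrix' (fderiv ℂ (forwardMap ℓ N) x : Params ℓ →ₗ[ℂ] (Fin N → ℂ))

/-- The component-wise condition number `CN_{α,N}(x) = ∑_i |(J_N(x)†)_{α,i}|`. -/
def condNumber (N : ℕ) (x : Params ℓ) (α : ParamIdx ℓ) : ℝ :=
  ∑ i : Fin N, ‖pinv (jacobian N x) α i‖

/-- The angular distance `δ_{rs} ∈ [0, π]` of the nodes `z_r` and `z_s` on the unit circle: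
`z̄_r z_s` has argument `arg z_s - arg z_r` modulo `2π`, and `Complex.arg` takes values in
`(-π, π]`. -/
def angularDist (x : Params ℓ) (r s : Fin 𝒦) : ℝ :=
  |Complex.arg (conj (node x r) * node x s)|

/-- The node separation `δ(x) = min_{r ≠ s} δ_{rs}`; the minimum over the empty set (at most one
node) is `∞`. -/
def separation (x : Params ℓ) : ℝ≥0∞ :=
  ⨅ (r : Fin 𝒦) (s : Fin 𝒦) (_ : r ≠ s), ENNReal.ofReal (angularDist x r s)

end Prony

end

open Prony

open scoped Matrix ENNReal NNReal ComplexConjugate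
namespace Prony
variable {𝒦 : ℕ} {ℓ : Fin 𝒦 → ℕ}

/-! By Cauchy–Schwarz the ℓ¹ norm of a row of `J†` is at most `√N` times its ℓ² norm, and the
squared ℓ² norm of row `α` is at most any `B` with `|w_α|² ≤ B ‖J w‖²` for all `w`. So only lower
bounds for `‖J w‖` are needed.

Since `∂/∂z (z^k k^i) = z⁻¹ z^k k^(i+1)`, the vector `J w` is a confluent Vandermonde matrix
(columns `z_j^k k^i`, `i ≤ ℓ_j`) applied to `c = vandermondeCoord x w`, with `c_{i,j} = w_{i,j} +
z_j⁻¹ a_{i-1,j} w_{z_j}` and top entry `z_j⁻¹ a_{ℓ_j-1,j} w_{z_j}`. Rescaling turns `k^i` into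
`(k/N)^i`. In the Gram form a single node contributes at least a constant times `N`
(`exists_poly_sample_bound`: compactness, with `|z_j| = 1` removing the node), while two distinct
nodes interact by `O(1/δ)` (Abel summation). For `N > K/δ` the diagonal wins
(`scaled_vandermonde_bound`), so `√N N^i |c_{i,j}| ≤ C ‖J w‖`. Solving for `w`, first at the node
and then at the coefficients, gives the estimates.

Full rank needs only distinct nonzero nodes: a polynomial of degree below `R` cannot have roots of
total multiplicity `R`. -/

/-! ### Rows of the pseudo-inverse -/

/-- A bound for a linear functional in terms of `A` bounds the row of the pseudo-inverse. -/
theorem sum_norm_sq_pinv_row_le {m n : Type*} [Fintype m] [Fintype n] (A : Matrix m n ℂ) (α : n)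
    {B : ℝ} (hB : 0 ≤ B) (h : ∀ w : n → ℂ, ‖w α‖ ^ 2 ≤ B * ∑ k, ‖(A *ᵥ w) k‖ ^ 2) :
    ∑ k, ‖pinv A α k‖ ^ 2 ≤ B := by
  have hP := pinv_spec A
  set P := pinv A
  -- The extremal test vector `P Pᴴ e_α`: it has `w_α = S`, and `A w` is the conjugated row, of
  -- squared norm `S`. The hypothesis becomes `S² ≤ B S`.
  set w : n → ℂ := P *ᵥ fun k => conj (P α k) with hw
  set S : ℝ := ∑ k, ‖P α k‖ ^ 2 with hS
  have hS0 : 0 ≤ S := Finset.sum_nonneg fun k _ => sq_nonneg _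
  have hwα : w α = (S : ℂ) := by
    simp only [hw, hS, Matrix.mulVec, dotProduct, Complex.mul_conj, Complex.normSq_eq_norm_sq]
    push_cast; rfl
  have hAw : A *ᵥ w = fun k => conj (P α k) := by
    have h1 : A * P * Pᴴ = Pᴴ := by
      rw [← hP.left_hermitian, ← Matrix.conjTranspose_mul, ← Matrix.mul_assoc, hP.self_mul_mul]
    funext k
    have h2 := congrFun (congrFun h1 k) α
    rw [hw, Matrix.mulVec_mulVec]
    exact h2
  have h3 := h w
  rw [hwα, hAw] at h3
  simp only [RCLike.norm_conj, ← hS, Complex.norm_real, Real.norm_of_nonneg hS0] at h3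
  rcases hS0.eq_or_lt with h0 | h0
  · rw [← h0]; exact hB
  · nlinarith

theorem sum_norm_pinv_row_le {N : ℕ} {n : Type*} [Fintype n] (A : Matrix (Fin N) n ℂ) (α : n)
    {B : ℝ} (hB : 0 ≤ B) (h : ∀ w : n → ℂ, N * ‖w α‖ ^ 2 ≤ B ^ 2 * ∑ k, ‖(A *ᵥ w) k‖ ^ 2) :
    ∑ k, ‖pinv A α k‖ ≤ B := by
  rcases Nat.eq_zero_or_pos N with rfl | hN
  · simpa using hB
  have hN' : (0 : ℝ) < N := by exact_mod_cast hN
  have h1 : ∑ k, ‖pinv A α k‖ ^ 2 ≤ B ^ 2 / N := by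
    refine sum_norm_sq_pinv_row_le A α (by positivity) fun w => ?_
    rw [div_mul_eq_mul_div, le_div_iff₀ hN', mul_comm]
    exact h w
  have h2 := sq_sum_le_card_mul_sum_sq (s := Finset.univ) (f := fun k => ‖pinv A α k‖)
  rw [Finset.card_univ, Fintype.card_fin] at h2
  rw [le_div_iff₀ hN', mul_comm] at h1
  exact le_of_sq_le_sq (h2.trans h1) hB

/-! ### Polynomials sampled at equispaced points -/

theorem sum_range_mul_eq (g : ℕ → ℝ) (q n : ℕ) :
    ∑ k ∈ Finset.range (q * n), g k = ∑ m ∈ Finset.range n, ∑ r ∈ Finset.range q, g (q * m + r) := by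
  induction n with
  | zero => simp
  | succ n ih => rw [Nat.mul_succ, Finset.sum_range_add, ih, Finset.sum_range_succ]

/-- Uniform lower bound for a polynomial sampled at well separated points of `[0, 1]`. -/
theorem exists_sampling_bound (d : ℕ) {η : ℝ} (hη : 0 < η) :
    ∃ μ : ℝ, 0 < μ ∧ ∀ t : Fin (d + 1) → ℝ, (∀ m, t m ∈ Set.Icc (0 : ℝ) 1) →
      (∀ m m', m ≠ m' → η ≤ |t m - t m'|) → ∀ b : Fin (d + 1) → ℂ,
      μ * ‖b‖ ^ 2 ≤ ∑ m, ‖∑ i, b i * (t m : ℂ) ^ (i : ℕ)‖ ^ 2 := by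
  set F : (Fin (d + 1) → ℝ) × (Fin (d + 1) → ℂ) → ℝ :=
    fun p => ∑ m, ‖∑ i, p.2 i * (p.1 m : ℂ) ^ (i : ℕ)‖ ^ 2 with hF
  have hFc : Continuous F := by fun_prop
  set T : Set (Fin (d + 1) → ℝ) :=
    Set.pi Set.univ (fun _ => Set.Icc (0 : ℝ) 1) ∩ {t | ∀ m m', m ≠ m' → η ≤ |t m - t m'|} with hT
  have hTc : IsCompact T := by
    refine (isCompact_univ_pi fun _ => isCompact_Icc).inter_right ?_
    simp only [Set.ofPred_forall]
    refine isClosed_iInter fun m => isClosed_iInter fun m' => isClosed_iInter fun _ => ?_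
    exact isClosed_le continuous_const (by fun_prop)
  have hK : IsCompact (T ×ˢ Metric.sphere (0 : Fin (d + 1) → ℂ) 1) :=
    hTc.prod (isCompact_sphere _ _)
  -- On the compact set of separated nodes and unit coefficient vectors, `F` vanishes nowhere, by
  -- Vandermonde. An empty set of nodes (large `η`) is allowed.
  obtain ⟨μ, hμ, hle⟩ := hK.exists_forall_le' hFc.continuousOn (a := 0) (by
    rintro ⟨t, b⟩ ⟨ht, hb⟩
    have h0 : 0 ≤ F (t, b) := Finset.sum_nonneg fun k _ => sq_nonneg _
    refine h0.lt_of_ne' fun h => ?_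
    have hz := (Finset.sum_eq_zero_iff_of_nonneg fun k _ => sq_nonneg _).1 h
    have hinj : Function.Injective fun m => (t m : ℂ) := by
      intro m m' hmm
      by_contra hne
      have : η ≤ |t m - t m'| := ht.2 m m' hne
      have h' : t m = t m' := Complex.ofReal_injective hmm
      rw [h', sub_self, abs_zero] at this
      linarith
    have hb0 : b = 0 := by
      refine Matrix.eq_zero_of_forall_index_sum_mul_pow_eq_zero hinj fun m => ?_
      have := hz m (Finset.mem_univ _)
      simpa using this
    simp [hb0] at hb)
  refine ⟨μ, hμ, fun t ht ht' b => ?_⟩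
  rcases eq_or_ne b 0 with rfl | hb
  · simp
  have hb' : (0 : ℝ) < ‖b‖ := norm_pos_iff.2 hb
  have h1 := hle (t, ((‖b‖⁻¹ : ℝ) : ℂ) • b) ⟨⟨fun m _ => ht m, ht'⟩, by
    rw [mem_sphere_zero_iff_norm, norm_smul, Complex.norm_real, norm_inv, norm_norm,
      inv_mul_cancel₀ hb'.ne']⟩
  have h2 : F (t, ((‖b‖⁻¹ : ℝ) : ℂ) • b) = (‖b‖⁻¹) ^ 2 * F (t, b) := by
    simp only [hF, Pi.smul_apply, smul_eq_mul, mul_assoc, ← Finset.mul_sum, norm_mul, mul_pow,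
      Complex.norm_real, norm_inv, norm_norm]
  rw [h2, inv_pow, inv_mul_eq_div, le_div_iff₀ (by positivity)] at h1
  exact h1

/-- Discrete polynomial norms dominate coefficient norms, uniformly in the number of samples. -/
theorem exists_poly_sample_bound (d : ℕ) : ∃ M : ℝ, 0 ≤ M ∧ ∀ N : ℕ, d + 1 ≤ N →
    ∀ b : Fin (d + 1) → ℂ, N * ∑ i, ‖b i‖ ^ 2 ≤
      M * ∑ k ∈ Finset.range N, ‖∑ i, b i * ((k / N : ℝ) : ℂ) ^ (i : ℕ)‖ ^ 2 := by
  have hη : (0 : ℝ) < 1 / (2 * (d + 1)) := by positivity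
  obtain ⟨μ, hμ, hs⟩ := exists_sampling_bound d hη
  refine ⟨2 * (d + 1) * (d + 1) / μ, by positivity, fun N hN b => ?_⟩
  have hN0 : (0 : ℝ) < N := by exact_mod_cast (by omega : 0 < N)
  -- For each offset `r < q`, the points `(q m + r)/N`, `m ≤ d`, have spacing at least `q/N ≥
  -- 1/(2(d+1))`. These `q` disjoint families fill `range (q (d+1))`, and the sampling bound is
  -- summed over them.
  set q := N / (d + 1) with hq
  have hqN : q * (d + 1) ≤ N := Nat.div_mul_le_self _ _
  have hq2 : N ≤ 2 * (d + 1) * q := by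
    have h1 : 1 ≤ q := (Nat.one_le_div_iff (by omega)).2 hN
    have h2 : N < (d + 1) * (q + 1) := Nat.lt_mul_div_succ N (by omega)
    nlinarith
  have hq2' : (N : ℝ) ≤ 2 * (d + 1) * q := by exact_mod_cast hq2
  set g : ℕ → ℝ := fun k => ‖∑ i, b i * ((k / N : ℝ) : ℂ) ^ (i : ℕ)‖ ^ 2 with hg
  have hb : ∑ i, ‖b i‖ ^ 2 ≤ (d + 1) * ‖b‖ ^ 2 := by
    calc ∑ i, ‖b i‖ ^ 2 ≤ ∑ _i : Fin (d + 1), ‖b‖ ^ 2 :=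
          Finset.sum_le_sum fun i _ => by gcongr; exact norm_le_pi_norm b i
      _ = _ := by simp
  have hr : ∀ r ∈ Finset.range q,
      μ * ‖b‖ ^ 2 ≤ ∑ m ∈ Finset.range (d + 1), g (q * m + r) := by
    intro r hr
    rw [Finset.mem_range] at hr
    rw [Finset.sum_range]
    refine hs (fun m => ((q * m + r : ℕ) : ℝ) / N) (fun m => ?_) (fun m m' hmm => ?_) b
    · refine ⟨by positivity, (div_le_one hN0).2 ?_⟩
      have : q * (m : ℕ) + r ≤ N := by
        have : (m : ℕ) ≤ d := by omega
        nlinarith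
      exact_mod_cast this
    · have h1 : (1 : ℝ) ≤ |((m : ℕ) : ℝ) - ((m' : ℕ) : ℝ)| := by
        have : ((m : ℕ) : ℤ) - ((m' : ℕ) : ℤ) ≠ 0 := by
          intro h; apply hmm; ext; omega
        exact_mod_cast Int.one_le_abs this
      have h2 : ((q * m + r : ℕ) : ℝ) / N - ((q * m' + r : ℕ) : ℝ) / N
          = q / N * (((m : ℕ) : ℝ) - ((m' : ℕ) : ℝ)) := by push_cast; ring
      rw [h2, abs_mul, abs_of_nonneg (by positivity)]
      calc 1 / (2 * ((d : ℝ) + 1)) ≤ q / N := by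
            rw [div_le_div_iff₀ (by positivity) hN0]; linarith
        _ ≤ _ := le_mul_of_one_le_right (by positivity) h1
  have hsum : q * (μ * ‖b‖ ^ 2) ≤ ∑ k ∈ Finset.range N, g k := by
    calc q * (μ * ‖b‖ ^ 2) = ∑ _r ∈ Finset.range q, μ * ‖b‖ ^ 2 := by simp
      _ ≤ ∑ r ∈ Finset.range q, ∑ m ∈ Finset.range (d + 1), g (q * m + r) :=
        Finset.sum_le_sum hr
      _ = ∑ k ∈ Finset.range (q * (d + 1)), g k := by
        rw [sum_range_mul_eq, Finset.sum_comm]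
      _ ≤ _ := Finset.sum_le_sum_of_subset_of_nonneg (Finset.range_mono hqN)
        fun k _ _ => sq_nonneg _
  rw [div_mul_eq_mul_div, le_div_iff₀ hμ]
  calc N * (∑ i, ‖b i‖ ^ 2) * μ ≤ (2 * (d + 1) * q) * ((d + 1) * ‖b‖ ^ 2) * μ := by gcongr
    _ = 2 * (d + 1) * (d + 1) * (q * (μ * ‖b‖ ^ 2)) := by ring
    _ ≤ _ := by gcongr

/-! ### Exponential sums and the Gram matrix -/

/-- Abel summation bound for an exponential sum with monotone weights. -/
theorem norm_one_sub_mul_sum_le {w : ℂ} (hw : ‖w‖ = 1) {g : ℕ → ℝ} (hg : Monotone g)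
    (h0 : 0 ≤ g 0) (n : ℕ) :
    ‖(1 - w) * ∑ k ∈ Finset.range n, w ^ k * (g k : ℂ)‖ ≤ 2 * g n := by
  have h1 : (1 - w) * ∑ k ∈ Finset.range n, w ^ k * (g k : ℂ) = (g 0 : ℂ) - w ^ n * (g n : ℂ)
      + ∑ k ∈ Finset.range n, w ^ (k + 1) * ((g (k + 1) - g k : ℝ) : ℂ) := by
    induction n with
    | zero => simp
    | succ n ih => rw [Finset.sum_range_succ, Finset.sum_range_succ, mul_add, ih]; push_cast; ring
  have hn : 0 ≤ g n := h0.trans (hg n.zero_le)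
  have h2 : ‖∑ k ∈ Finset.range n, w ^ (k + 1) * ((g (k + 1) - g k : ℝ) : ℂ)‖ ≤ g n - g 0 := by
    refine (norm_sum_le _ _).trans (le_of_eq ?_)
    rw [← Finset.sum_range_sub]
    refine Finset.sum_congr rfl fun k _ => ?_
    rw [norm_mul, norm_pow, hw, one_pow, one_mul, Complex.norm_real,
      Real.norm_of_nonneg (sub_nonneg.2 (hg k.le_succ))]
  rw [h1]
  refine (norm_add_le _ _).trans ?_
  have h3 : ‖(g 0 : ℂ) - w ^ n * (g n : ℂ)‖ ≤ g 0 + g n := by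
    refine (norm_sub_le _ _).trans (le_of_eq ?_)
    rw [norm_mul, norm_pow, hw, one_pow, one_mul, Complex.norm_real, Complex.norm_real,
      Real.norm_of_nonneg h0, Real.norm_of_nonneg hn]
  linarith

/-- Abel summation with the increasing weights `(k/N)^p`, whose value at `N` is `1`, bounds the sum
by `2/|1 - w|`; an arc is at most `π/2` times its chord. The bound is independent of `p` and `N`. -/
theorem abs_arg_mul_norm_sum_le {w : ℂ} (hw : ‖w‖ = 1) {N : ℕ} (hN : 0 < N) (p : ℕ) :
    |w.arg| * ‖∑ k ∈ Finset.range N, w ^ k * ((k / N : ℝ) : ℂ) ^ p‖ ≤ Real.pi := by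
  have hN0 : (0 : ℝ) < N := by exact_mod_cast hN
  have h1 := norm_one_sub_mul_sum_le hw (g := fun k => ((k : ℝ) / N) ^ p)
    (fun a b hab => by dsimp only; gcongr) (by positivity) N
  rw [div_self hN0.ne', one_pow, norm_mul] at h1
  have h2 := Complex.angle_le_mul_norm_sub (x := 1) (y := w) (by simp) hw
  rw [Complex.angle_one_left (by rw [← norm_pos_iff, hw]; norm_num)] at h2
  push_cast at h1 ⊢
  calc _ ≤ Real.pi / 2 * ‖1 - w‖ * ‖∑ k ∈ Finset.range N, w ^ k * ((k : ℂ) / N) ^ p‖ := by gcongr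
    _ = Real.pi / 2 * (‖1 - w‖ * ‖∑ k ∈ Finset.range N, w ^ k * ((k : ℂ) / N) ^ p‖) := by ring
    _ ≤ Real.pi / 2 * (2 * 1) := by gcongr
    _ = Real.pi := by ring

/-- Expanding the products gives exponential sums in `conj z * u`, each of size at most `π/|arg| ≤
E`. -/
theorem norm_sum_conj_mul_le {d e N : ℕ} (hN : 0 < N) {z u : ℂ} (hz : ‖z‖ = 1) (hu : ‖u‖ = 1)
    {E : ℝ} (hE : Real.pi ≤ E * |(conj z * u).arg|)
    (b : Fin d → ℂ) (c : Fin e → ℂ) :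
    ‖∑ k ∈ Finset.range N, conj (z ^ k * ∑ i, b i * ((k / N : ℝ) : ℂ) ^ (i : ℕ)) *
      (u ^ k * ∑ i, c i * ((k / N : ℝ) : ℂ) ^ (i : ℕ))‖ ≤ E * ((∑ i, ‖b i‖) * ∑ i, ‖c i‖) := by
  have hw : ‖conj z * u‖ = 1 := by rw [norm_mul, RCLike.norm_conj, hz, hu, one_mul]
  have hpos : 0 < |(conj z * u).arg| := by
    refine (abs_nonneg _).lt_of_ne fun h => ?_
    rw [← h, mul_zero] at hE
    exact absurd hE (not_le.2 Real.pi_pos)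
  have hX : ∀ p : ℕ, ‖∑ k ∈ Finset.range N, (conj z * u) ^ k * ((k / N : ℝ) : ℂ) ^ p‖ ≤ E :=
    fun p => le_of_mul_le_mul_left
      ((abs_arg_mul_norm_sum_le hw hN p).trans (hE.trans_eq (mul_comm _ _))) hpos
  have h1 : ∑ k ∈ Finset.range N, conj (z ^ k * ∑ i, b i * ((k / N : ℝ) : ℂ) ^ (i : ℕ)) *
      (u ^ k * ∑ i, c i * ((k / N : ℝ) : ℂ) ^ (i : ℕ)) =
      ∑ i, ∑ i', conj (b i) * c i' * ∑ k ∈ Finset.range N,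
        (conj z * u) ^ k * ((k / N : ℝ) : ℂ) ^ ((i : ℕ) + (i' : ℕ)) := by
    simp only [Finset.mul_sum]
    simp_rw [Finset.sum_comm (t := Finset.range N)]
    refine Finset.sum_congr rfl fun k _ => ?_
    simp only [map_mul, map_pow, map_sum, Complex.conj_ofReal, Finset.sum_mul]
    rw [Finset.sum_comm]
    refine Finset.sum_congr rfl fun i _ => Finset.sum_congr rfl fun i' _ => ?_
    rw [pow_add, mul_pow]; ring
  rw [h1, Finset.sum_mul_sum, Finset.mul_sum]
  refine (norm_sum_le _ _).trans (Finset.sum_le_sum fun i _ => ?_)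
  rw [Finset.mul_sum]
  refine (norm_sum_le _ _).trans (Finset.sum_le_sum fun i' _ => ?_)
  rw [norm_mul, norm_mul, RCLike.norm_conj, mul_comm]
  gcongr
  exact hX _

/-- The scaled confluent Vandermonde matrix is well conditioned for well separated nodes. -/
theorem scaled_vandermonde_bound {N : ℕ} (hN : 0 < N) {z : Fin 𝒦 → ℂ} (hz : ∀ j, ‖z j‖ = 1)
    {M E : ℝ} (hM0 : 0 ≤ M) (hE0 : 0 ≤ E)
    (hM : ∀ j, ∀ b : Fin (ℓ j + 1) → ℂ, N * ∑ i, ‖b i‖ ^ 2 ≤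
      M * ∑ k ∈ Finset.range N, ‖∑ i, b i * ((k / N : ℝ) : ℂ) ^ (i : ℕ)‖ ^ 2)
    (hE : ∀ r s, r ≠ s → Real.pi ≤ E * |(conj (z r) * z s).arg|)
    (hME : 2 * (M * E * Fintype.card (ParamIdx ℓ)) ≤ N) (b : Params ℓ) :
    N * ∑ α, ‖b α‖ ^ 2 ≤ 2 * M * ∑ k ∈ Finset.range N,
      ‖∑ j, z j ^ k * ∑ i : Fin (ℓ j + 1), b ⟨j, i⟩ * ((k / N : ℝ) : ℂ) ^ (i : ℕ)‖ ^ 2 := by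
  set p : Fin 𝒦 → ℕ → ℂ := fun j k => ∑ i : Fin (ℓ j + 1), b ⟨j, i⟩ * ((k / N : ℝ) : ℂ) ^ (i : ℕ)
    with hp
  set B : Fin 𝒦 → ℝ := fun j => ∑ i : Fin (ℓ j + 1), ‖b ⟨j, i⟩‖ with hB
  have hB0 : ∀ j, 0 ≤ B j := fun j => Finset.sum_nonneg fun i _ => norm_nonneg _
  set D : Fin 𝒦 → ℝ := fun j => ∑ k ∈ Finset.range N, ‖p j k‖ ^ 2 with hD
  set S : ℝ := ∑ α, ‖b α‖ ^ 2 with hS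
  set Q : ℝ := ∑ k ∈ Finset.range N, ‖∑ j, z j ^ k * p j k‖ ^ 2 with hQ
  have hexp : Q = ∑ r, ∑ s, (∑ k ∈ Finset.range N,
      conj (z r ^ k * p r k) * (z s ^ k * p s k)).re := by
    have h1 : ∀ k, ‖∑ j, z j ^ k * p j k‖ ^ 2 =
        ∑ r, ∑ s, (conj (z r ^ k * p r k) * (z s ^ k * p s k)).re := by
      intro k
      have h2 : ((‖∑ j, z j ^ k * p j k‖ ^ 2 : ℝ) : ℂ) =
          ∑ r, ∑ s, conj (z r ^ k * p r k) * (z s ^ k * p s k) := by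
        rw [← Finset.sum_mul_sum, ← map_sum, Complex.conj_mul']
        push_cast; rfl
      have h3 := congrArg Complex.re h2
      rw [Complex.ofReal_re] at h3
      rw [h3]
      simp only [Complex.re_sum]
    rw [hQ, Finset.sum_congr rfl fun k _ => h1 k, Finset.sum_comm]
    refine Finset.sum_congr rfl fun r _ => ?_
    rw [Finset.sum_comm]
    simp only [Complex.re_sum]
  -- `E B_r²` is also subtracted on the diagonal, so that the error terms add up to `E (∑ B_r)²`.
  have hlow : ∑ r, ∑ s, ((if r = s then D r else 0) - E * (B r * B s)) ≤ Q := by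
    rw [hexp]
    refine Finset.sum_le_sum fun r _ => Finset.sum_le_sum fun s _ => ?_
    by_cases hrs : r = s
    · subst hrs
      have : (∑ k ∈ Finset.range N, conj (z r ^ k * p r k) * (z r ^ k * p r k)).re = D r := by
        rw [Complex.re_sum]
        refine Finset.sum_congr rfl fun k _ => ?_
        rw [Complex.conj_mul', norm_mul, norm_pow, hz, one_pow, one_mul, ← Complex.ofReal_pow,
          Complex.ofReal_re]
      rw [this, if_pos rfl]
      have := mul_nonneg hE0 (mul_nonneg (hB0 r) (hB0 r))
      linarith
    · rw [if_neg hrs, zero_sub]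
      have h1 := norm_sum_conj_mul_le hN (hz r) (hz s) (hE r s hrs)
        (fun i => b ⟨r, i⟩) (fun i => b ⟨s, i⟩)
      exact (neg_le_neg h1).trans (neg_le_of_abs_le (Complex.abs_re_le_norm _))
  have hlow' : ∑ r, D r - E * (∑ r, B r) ^ 2 ≤ Q := by
    refine le_trans (le_of_eq ?_) hlow
    simp only [Finset.sum_sub_distrib, Finset.sum_ite_eq, Finset.mem_univ, if_true,
      ← Finset.mul_sum]
    rw [sq, Finset.sum_mul_sum]
    simp only [Finset.mul_sum]
  have hBS : (∑ r, B r) ^ 2 ≤ Fintype.card (ParamIdx ℓ) * S := by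
    have h1 : ∑ r, B r = ∑ α : ParamIdx ℓ, ‖b α‖ := by rw [hB, Fintype.sum_sigma]
    rw [h1]
    exact sq_sum_le_card_mul_sum_sq
  have hdiag : N * S ≤ M * ∑ r, D r := by
    rw [hS, Fintype.sum_sigma, Finset.mul_sum, Finset.mul_sum]
    exact Finset.sum_le_sum fun j _ => hM j fun i => b ⟨j, i⟩
  have hS0 : 0 ≤ S := Finset.sum_nonneg fun k _ => sq_nonneg _
  have h5 : M * (∑ r, D r) ≤ M * (Q + E * (Fintype.card (ParamIdx ℓ) * S)) := by
    gcongr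
    have := mul_le_mul_of_nonneg_left hBS hE0
    linarith
  have h6 := mul_le_mul_of_nonneg_right hME hS0
  -- `N S ≤ M Q + M E R S`, and `hME` absorbs the last term into `N S / 2`.
  nlinarith

/-! ### Injectivity of the confluent Vandermonde matrix -/

-- The operator `P ↦ X P'` multiplies the `k`-th coefficient by `k`, so it shifts the moment
-- conditions by one. By induction `(X - z)^(n+1)` divides `X P'`, hence `P'` as `z ≠ 0`, and a root
-- of `P` has multiplicity one more than in `P'`.
open Polynomial in
theorem X_sub_C_pow_dvd_of_forall_sum_eq_zero {z : ℂ} (hz : z ≠ 0) {R : ℕ} (n : ℕ) :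
    ∀ P : ℂ[X], P.natDegree < R →
      (∀ i ≤ n, ∑ k ∈ Finset.range R, P.coeff k * ((k : ℂ) ^ i * z ^ k) = 0) →
      (X - C z) ^ (n + 1) ∣ P := by
  have hroot : ∀ P : ℂ[X], P.natDegree < R →
      ∑ k ∈ Finset.range R, P.coeff k * ((k : ℂ) ^ 0 * z ^ k) = 0 → P.IsRoot z := by
    intro P hP h
    rw [IsRoot.def, eval_eq_sum_range' hP]
    simpa using h
  induction n with
  | zero =>
    intro P hP h
    rw [zero_add, pow_one, dvd_iff_isRoot]
    exact hroot P hP (h 0 le_rfl)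
  | succ n ih =>
    intro P hP h
    have hr := hroot P hP (h 0 (Nat.zero_le _))
    rcases eq_or_ne P 0 with rfl | hP0
    · exact dvd_zero _
    have hcoeff : ∀ k, (X * derivative P).coeff k = k * P.coeff k := by
      intro k
      cases k with
      | zero => simp
      | succ k => rw [coeff_X_mul, coeff_derivative]; push_cast; ring
    have hdeg0 : P.natDegree ≠ 0 := by
      intro h0
      rw [eq_C_of_natDegree_eq_zero h0, IsRoot.def, eval_C] at hr
      exact hP0 (by rw [eq_C_of_natDegree_eq_zero h0, hr, C_0])
    have hd0 : derivative P ≠ 0 := fun h0 => hdeg0 (derivative_eq_zero.1 h0)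
    have hdvd : (X - C z) ^ (n + 1) ∣ X * derivative P := by
      refine ih _ ?_ fun i hi => ?_
      · refine lt_of_le_of_lt ?_ hP
        rw [natDegree_le_iff_coeff_eq_zero]
        intro k hk
        rw [hcoeff, coeff_eq_zero_of_natDegree_lt hk, mul_zero]
      · rw [← h (i + 1) (by omega)]
        refine Finset.sum_congr rfl fun k _ => ?_
        rw [hcoeff]; ring
    have hcop : IsCoprime ((X - C z) ^ (n + 1)) (X : ℂ[X]) := by
      refine IsCoprime.pow_left ?_
      have := isCoprime_X_sub_C_of_isUnit_sub (R := ℂ) (a := z) (b := 0)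
        (by rw [sub_zero]; exact hz.isUnit)
      simpa using this
    have h1 := (le_rootMultiplicity_iff hd0).2 (hcop.dvd_of_dvd_mul_left hdvd)
    rw [derivative_rootMultiplicity_of_root hr] at h1
    exact (le_rootMultiplicity_iff hP0).1 (by omega)

theorem card_paramIdx (ℓ : Fin 𝒦 → ℕ) : Fintype.card (ParamIdx ℓ) = numParams ℓ := by
  simp [numParams, Finset.sum_add_distrib]

-- A kernel vector of the square transposed matrix is a polynomial of degree below `R` divisible by
-- `∏ (X - z_j)^(ℓ_j+1)`, of degree `R`, hence zero. The transpose is therefore surjective, and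
-- pairing `c` with a preimage of `e_α` gives `c_α = 0`. Only the first `R` samples are used.
open Polynomial in
theorem confluent_vandermonde_eq_zero {z : Fin 𝒦 → ℂ} (hz : ∀ j, z j ≠ 0)
    (hinj : Function.Injective z) {N : ℕ} (hN : numParams ℓ ≤ N) {c : Params ℓ}
    (hc : ∀ k < N, ∑ j, z j ^ k * ∑ i : Fin (ℓ j + 1), c ⟨j, i⟩ * (k : ℂ) ^ (i : ℕ) = 0) :
    c = 0 := by
  classical
  set R := numParams ℓ with hR
  set V : Matrix (ParamIdx ℓ) (Fin R) ℂ :=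
    Matrix.of fun α k => ((k : ℕ) : ℂ) ^ (α.2 : ℕ) * z α.1 ^ (k : ℕ) with hV
  have hVinj : Function.Injective V.mulVecLin := by
    rw [← LinearMap.ker_eq_bot, LinearMap.ker_eq_bot']
    intro u hu
    set P : ℂ[X] := ∑ k : Fin R, C (u k) * X ^ (k : ℕ) with hP
    have hcoeff : ∀ k : Fin R, P.coeff k = u k := by
      intro k
      simp only [hP, finsetSum_coeff, coeff_C_mul, coeff_X_pow, mul_ite, mul_one, mul_zero,
        Fin.val_inj, Finset.sum_ite_eq, Finset.mem_univ, if_true]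
    have hPdeg : P.degree < R := by
      refine (degree_sum_le _ _).trans_lt ((Finset.sup_lt_iff (WithBot.bot_lt_coe _)).2 ?_)
      intro k _
      exact (degree_C_mul_X_pow_le _ _).trans_lt (by exact_mod_cast k.2)
    suffices hP0 : P = 0 by
      funext k
      rw [← hcoeff, hP0, coeff_zero, Pi.zero_apply]
    by_contra hP0
    have hdvd : ∀ j, (X - C (z j)) ^ (ℓ j + 1) ∣ P := by
      intro j
      refine X_sub_C_pow_dvd_of_forall_sum_eq_zero (hz j) (R := R) _ P
        ((natDegree_lt_iff_degree_lt hP0).2 hPdeg) fun i hi => ?_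
      have h1 := congrFun hu ⟨j, ⟨i, by omega⟩⟩
      rw [Finset.sum_range, ← Pi.zero_apply (M := fun _ : ParamIdx ℓ => ℂ) ⟨j, ⟨i, by omega⟩⟩, ← h1]
      simp only [Matrix.mulVecLin_apply, Matrix.mulVec, dotProduct, hV, Matrix.of_apply]
      refine Finset.sum_congr rfl fun k _ => ?_
      rw [hcoeff, mul_comm]
    have hprod : ∏ j, (X - C (z j)) ^ (ℓ j + 1) ∣ P :=
      Finset.prod_dvd_of_coprime (fun r _ s _ hrs =>
        (pairwise_coprime_X_sub_C hinj hrs).pow) fun j _ => hdvd j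
    refine hP0 (eq_zero_of_dvd_of_degree_lt hprod (hPdeg.trans_le (le_of_eq ?_)))
    rw [degree_prod]
    simp [degree_pow, hR, numParams, Finset.sum_add_distrib]
  have hVsurj : Function.Surjective V.mulVecLin :=
    (LinearMap.injective_iff_surjective_of_finrank_eq_finrank (by
      rw [Module.finrank_fintype_fun_eq_card, Module.finrank_fintype_fun_eq_card, card_paramIdx,
        Fintype.card_fin])).1 hVinj
  funext α
  obtain ⟨u, hu⟩ := hVsurj (Pi.single α 1)
  have h1 : ∑ β, c β * (V.mulVecLin u) β = 0 := by
    simp only [Matrix.mulVecLin_apply, Matrix.mulVec, dotProduct, Finset.mul_sum]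
    rw [Finset.sum_comm]
    refine Finset.sum_eq_zero fun k _ => ?_
    have h2 := congrArg (· * u k) (hc k (k.2.trans_le hN))
    simp only [zero_mul] at h2
    rw [← h2, Fintype.sum_sigma, Finset.sum_mul]
    refine Finset.sum_congr rfl fun j _ => ?_
    rw [Finset.mul_sum, Finset.sum_mul]
    refine Finset.sum_congr rfl fun i _ => ?_
    simp only [hV, Matrix.of_apply]; ring
  rw [hu] at h1
  simpa [Pi.single_apply] using h1

/-! ### The Jacobian -/

theorem coeff_natCast (x : Params ℓ) (j : Fin 𝒦) (i : Fin (ℓ j)) :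
    coeff x j ((i : ℕ) : ℤ) = x (coeffIdx j i) := by
  rw [coeff, dif_pos ⟨by positivity, by exact_mod_cast i.2⟩]
  congr

theorem coeff_neg_one (x : Params ℓ) (j : Fin 𝒦) : coeff x j (-1) = 0 := by
  rw [coeff, dif_neg (by omega)]

/-- Coordinates of the image of `w` under the Jacobian at `x`, relative to the columns of the
confluent Vandermonde matrix. -/
noncomputable def vandermondeCoord (x w : Params ℓ) : Params ℓ := fun α =>
  (Fin.lastCases 0 (fun i => w (coeffIdx α.1 i)) α.2 : ℂ) +
    (node x α.1)⁻¹ * coeff x α.1 ((α.2 : ℤ) - 1) * w (nodeIdx α.1)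

theorem vandermondeCoord_coeffIdx (x w : Params ℓ) (j : Fin 𝒦) (i : Fin (ℓ j)) :
    vandermondeCoord x w (coeffIdx j i) = w (coeffIdx j i) +
      (node x j)⁻¹ * coeff x j ((i : ℤ) - 1) * w (nodeIdx j) := by
  simp [vandermondeCoord, coeffIdx]

theorem vandermondeCoord_nodeIdx (x w : Params ℓ) (j : Fin 𝒦) :
    vandermondeCoord x w (nodeIdx j) =
      (node x j)⁻¹ * coeff x j ((ℓ j : ℤ) - 1) * w (nodeIdx j) := by
  simp [vandermondeCoord, nodeIdx]

theorem sum_vandermondeCoord (x w : Params ℓ) (j : Fin 𝒦) (t : ℂ) :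
    ∑ i : Fin (ℓ j + 1), vandermondeCoord x w ⟨j, i⟩ * t ^ (i : ℕ) =
      (∑ i : Fin (ℓ j), w (coeffIdx j i) * t ^ (i : ℕ)) +
        (node x j)⁻¹ * t * w (nodeIdx j) * ∑ i : Fin (ℓ j), x (coeffIdx j i) * t ^ (i : ℕ) := by
  simp only [vandermondeCoord, add_mul, Finset.sum_add_distrib]
  congr 1
  · rw [Fin.sum_univ_castSucc]
    simp
  -- The factor `t` raises each exponent by one; the term `i = 0` drops out because `a_{-1,j} = 0`.
  · rw [Fin.sum_univ_succ]
    have h0 : coeff x j (((0 : Fin (ℓ j + 1)) : ℕ) - 1 : ℤ) = 0 := by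
      simpa using coeff_neg_one x j
    rw [h0, mul_zero, zero_mul, zero_mul, zero_add, Finset.mul_sum]
    refine Finset.sum_congr rfl fun i _ => ?_
    have h1 : (((i.succ : Fin (ℓ j + 1)) : ℕ) : ℤ) - 1 = ((i : ℕ) : ℤ) := by simp
    rw [h1, coeff_natCast, Fin.val_succ, pow_succ]
    ring

theorem jacobian_mulVec (N : ℕ) (x w : Params ℓ) (hx : ∀ j, node x j ≠ 0) (k : Fin N) :
    (jacobian N x *ᵥ w) k = ∑ j, node x j ^ (k : ℕ) *
      ∑ i : Fin (ℓ j + 1), vandermondeCoord x w ⟨j, i⟩ * ((k : ℕ) : ℂ) ^ (i : ℕ) := by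
  have hdiff : DifferentiableAt ℂ (forwardMap ℓ N) x := by
    unfold forwardMap node
    fun_prop
  have h1 : jacobian N x *ᵥ w = fderiv ℂ (forwardMap ℓ N) x w := by
    rw [jacobian, LinearMap.toMatrix'_mulVec]; rfl
  have h2 : HasDerivAt (fun t : ℂ => forwardMap ℓ N (x + t • w) k)
      (fderiv ℂ (forwardMap ℓ N) x w k) 0 :=
    hasDerivAt_pi.1 (hdiff.hasFDerivAt.hasLineDerivAt w) k
  rw [h1]
  refine h2.unique ?_
  simp only [forwardMap, node, Pi.add_apply, Pi.smul_apply, smul_eq_mul]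
  refine HasDerivAt.fun_sum fun j _ => ?_
  have hz := hx j
  have hlin : ∀ a b : ℂ, HasDerivAt (fun t : ℂ => a + t * b) b 0 := fun a b => by
    simpa using ((hasDerivAt_id (0 : ℂ)).mul_const b).const_add a
  have h3 := ((hlin (x (nodeIdx j)) (w (nodeIdx j))).fun_pow (k : ℕ)).fun_mul
    (HasDerivAt.fun_sum (u := Finset.univ) fun (i : Fin (ℓ j)) _ =>
      (hlin (x (coeffIdx j i)) (w (coeffIdx j i))).mul_const (((k : ℕ) : ℂ) ^ (i : ℕ)))
  refine h3.congr_deriv (Eq.symm ?_)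
  rw [sum_vandermondeCoord]
  simp only [zero_mul, add_zero]
  have h4 : node x j = x (nodeIdx j) := rfl
  rw [h4] at hz ⊢
  -- With truncated subtraction, `k - 1 = 0` at `k = 0`; both sides vanish there.
  have h5 : ((k : ℕ) : ℂ) * x (nodeIdx j) ^ ((k : ℕ) - 1) =
      x (nodeIdx j) ^ (k : ℕ) * ((x (nodeIdx j))⁻¹ * ((k : ℕ) : ℂ)) := by
    rcases Nat.eq_zero_or_pos (k : ℕ) with h0 | h0
    · simp [h0]
    · obtain ⟨n, hn⟩ : ∃ n, (k : ℕ) = n + 1 := ⟨k - 1, by omega⟩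
      rw [hn, Nat.add_sub_cancel, pow_succ]
      field_simp
  rw [h5]
  ring

/-! ### Separation of the nodes and full rank -/

theorem node_ne_zero {x : Params ℓ} (hx : ∀ j, ‖node x j‖ = 1) (j : Fin 𝒦) : node x j ≠ 0 := by
  rw [← norm_pos_iff, hx]; exact one_pos

theorem separation_le (x : Params ℓ) {r s : Fin 𝒦} (hrs : r ≠ s) :
    separation x ≤ ENNReal.ofReal (angularDist x r s) :=
  iInf_le_of_le r (iInf_le_of_le s (iInf_le _ hrs))

theorem angularDist_pos {x : Params ℓ} (hsep : 0 < separation x) {r s : Fin 𝒦} (hrs : r ≠ s) :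
    0 < angularDist x r s :=
  ENNReal.ofReal_pos.1 (hsep.trans_le (separation_le x hrs))

theorem node_injective {x : Params ℓ} (hx : ∀ j, ‖node x j‖ = 1) (hsep : 0 < separation x) :
    Function.Injective (node x) := by
  intro r s h
  by_contra hrs
  have h1 := angularDist_pos hsep hrs
  rw [angularDist, h, Complex.conj_mul', hx] at h1
  simp at h1

/-- The separation may be `∞`, but the distance of one given pair is finite and positive, so the
condition can be cleared of its inverse and read in `ℝ`. -/
theorem lt_mul_angularDist {x : Params ℓ} (hsep : 0 < separation x) {K : ℝ≥0} {N : ℕ}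
    (h : (K : ℝ≥0∞) * (separation x)⁻¹ < (N : ℝ≥0∞)) {r s : Fin 𝒦} (hrs : r ≠ s) :
    (K : ℝ) < N * angularDist x r s := by
  have hd := angularDist_pos hsep hrs
  have h1 : (K : ℝ≥0∞) / ENNReal.ofReal (angularDist x r s) < (N : ℝ≥0∞) := by
    rw [div_eq_mul_inv]
    exact (mul_le_mul_right (ENNReal.inv_le_inv.2 (separation_le x hrs)) _).trans_lt h
  rw [ENNReal.div_lt_iff (Or.inl (ENNReal.ofReal_pos.2 hd).ne') (Or.inl ENNReal.ofReal_ne_top)]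
    at h1
  have h2 := (ENNReal.toReal_lt_toReal ENNReal.coe_ne_top
    (ENNReal.mul_ne_top (ENNReal.natCast_ne_top N) ENNReal.ofReal_ne_top)).2 h1
  simpa [ENNReal.toReal_ofReal hd.le] using h2

theorem jacobian_rank {N : ℕ} {x : Params ℓ} (hN : numParams ℓ ≤ N) (hx : ∀ j, ‖node x j‖ = 1)
    (hsep : 0 < separation x) (htop : ∀ j, coeff x j ((ℓ j : ℤ) - 1) ≠ 0) :
    (jacobian N x).rank = numParams ℓ := by
  have hz := node_ne_zero hx
  have hinj : Function.Injective (jacobian N x).mulVecLin := by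
    rw [← LinearMap.ker_eq_bot, LinearMap.ker_eq_bot']
    intro w hw
    have hc : vandermondeCoord x w = 0 := by
      refine confluent_vandermonde_eq_zero hz (node_injective hx hsep) hN fun k hk => ?_
      have h1 := congrFun hw ⟨k, hk⟩
      rwa [Matrix.mulVecLin_apply, jacobian_mulVec N x w hz] at h1
    have hnode : ∀ j, w (nodeIdx j) = 0 := by
      intro j
      have h1 := congrFun hc (nodeIdx j)
      rw [vandermondeCoord_nodeIdx] at h1
      simpa [hz j, htop j] using h1
    funext α
    obtain ⟨j, i⟩ := α
    induction i using Fin.lastCases with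
    | last => exact hnode j
    | cast i =>
      have h1 := congrFun hc (coeffIdx j i)
      rw [vandermondeCoord_coeffIdx, hnode, mul_zero, add_zero] at h1
      exact h1
  rw [Matrix.rank, LinearMap.finrank_range_of_inj hinj, Module.finrank_fintype_fun_eq_card,
    card_paramIdx]

/-! ### Uniform bound for the Vandermonde coordinates -/

theorem exists_vandermondeCoord_bound (ℓ : Fin 𝒦 → ℕ) : ∃ (K : ℝ≥0) (C : ℝ), 0 ≤ C ∧
    ∀ (N : ℕ) (x : Params ℓ), numParams ℓ ≤ N → (∀ j, ‖node x j‖ = 1) → 0 < separation x →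
      (K : ℝ≥0∞) * (separation x)⁻¹ < (N : ℝ≥0∞) → ∀ (w : Params ℓ) (α : ParamIdx ℓ),
      √N * ((N : ℝ) ^ (α.2 : ℕ) * ‖vandermondeCoord x w α‖) ≤
        C * √(∑ k, ‖(jacobian N x *ᵥ w) k‖ ^ 2) := by
  choose M₀ hM₀ hM using exists_poly_sample_bound
  set M : ℝ := ∑ j, M₀ (ℓ j) with hMdef
  have hM0 : 0 ≤ M := Finset.sum_nonneg fun j _ => hM₀ _
  -- With `E = π N / K`, the condition `K < N δ_{rs}` gives `π ≤ E δ_{rs}`, and `2 M E R ≤ N`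
  -- amounts to `2 π M R ≤ K`; the `+ 1` keeps `K` positive.
  set K : ℝ := 2 * Real.pi * (M * Fintype.card (ParamIdx ℓ)) + 1 with hK
  have hK0 : 0 < K := by positivity
  refine ⟨K.toNNReal, √(2 * M), Real.sqrt_nonneg _, fun N x hN hx hsep hNK w α => ?_⟩
  have hℓN : ∀ j, ℓ j + 1 ≤ N := by
    intro j
    refine le_trans ?_ hN
    rw [← card_paramIdx, Fintype.card_sigma]
    simpa using Finset.single_le_sum (f := fun j => ℓ j + 1) (fun _ _ => Nat.zero_le _)
      (Finset.mem_univ j)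
  have hN0 : 0 < N := lt_of_lt_of_le (Nat.succ_pos _) (hℓN α.1)
  have hN0' : (0 : ℝ) < N := by exact_mod_cast hN0
  set b : Params ℓ := fun β => (N : ℂ) ^ (β.2 : ℕ) * vandermondeCoord x w β with hb
  have key := scaled_vandermonde_bound (ℓ := ℓ) hN0 (z := node x) hx (M := M)
    (E := Real.pi * N / K) hM0 (by positivity) (fun j b => ?_) (fun r s hrs => ?_) ?_ b
  · have h1 : ∑ k ∈ Finset.range N, ‖∑ j, node x j ^ k *
        ∑ i : Fin (ℓ j + 1), b ⟨j, i⟩ * ((k / N : ℝ) : ℂ) ^ (i : ℕ)‖ ^ 2 =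
        ∑ k, ‖(jacobian N x *ᵥ w) k‖ ^ 2 := by
      rw [Finset.sum_range]
      refine Finset.sum_congr rfl fun k _ => ?_
      rw [jacobian_mulVec N x w (node_ne_zero hx)]
      congr 2
      refine Finset.sum_congr rfl fun j _ => ?_
      congr 1
      refine Finset.sum_congr rfl fun i _ => ?_
      have hNC : (N : ℂ) ≠ 0 := by exact_mod_cast hN0.ne'
      simp only [hb]
      push_cast
      rw [div_pow]
      field_simp
    rw [h1] at key
    have h2 : N * ‖b α‖ ^ 2 ≤ 2 * M * ∑ k, ‖(jacobian N x *ᵥ w) k‖ ^ 2 := by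
      refine le_trans ?_ key
      gcongr
      exact Finset.single_le_sum (f := fun β => ‖b β‖ ^ 2) (fun _ _ => sq_nonneg _)
        (Finset.mem_univ α)
    have h3 := Real.sqrt_le_sqrt h2
    rw [Real.sqrt_mul hN0'.le, Real.sqrt_sq (norm_nonneg _), Real.sqrt_mul (by positivity)] at h3
    simpa [hb] using h3
  · refine (hM (ℓ j) N (hℓN j) b).trans ?_
    gcongr
    exact Finset.single_le_sum (f := fun j => M₀ (ℓ j)) (fun j _ => hM₀ _) (Finset.mem_univ j)
  · have h1 := lt_mul_angularDist hsep hNK hrs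
    rw [Real.coe_toNNReal _ hK0.le, angularDist] at h1
    rw [div_mul_eq_mul_div, le_div_iff₀ hK0, mul_assoc]
    gcongr
  · have h1 : 2 * (M * (Real.pi * N / K) * Fintype.card (ParamIdx ℓ)) =
        N * ((2 * Real.pi * (M * Fintype.card (ParamIdx ℓ))) / K) := by ring
    rw [h1]
    refine mul_le_of_le_one_right hN0'.le ((div_le_one hK0).2 ?_)
    rw [hK]; linarith

theorem condNumber_le_of_forall {N : ℕ} (x : Params ℓ) (α : ParamIdx ℓ) {B : ℝ} (hB : 0 ≤ B)
    (h : ∀ w : Params ℓ, √N * ‖w α‖ ≤ B * √(∑ k, ‖(jacobian N x *ᵥ w) k‖ ^ 2)) :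
    condNumber N x α ≤ B := by
  refine sum_norm_pinv_row_le _ α hB fun w => ?_
  have h1 := pow_le_pow_left₀ (by positivity) (h w) 2
  rwa [mul_pow, mul_pow, Real.sq_sqrt (Nat.cast_nonneg _),
    Real.sq_sqrt (Finset.sum_nonneg fun _ _ => sq_nonneg _)] at h1

end Prony

open Prony
theorem theorem2p2 {𝒦 : ℕ} (ℓ : Fin 𝒦 → ℕ) (hℓ : ∀ j, 1 ≤ ℓ j) :
    (∀ (N : ℕ) (x : Params ℓ), numParams ℓ ≤ N → (∀ j, ‖node x j‖ = 1) → 0 < separation x →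
      (∀ j, coeff x j ((ℓ j : ℤ) - 1) ≠ 0) → (jacobian N x).rank = numParams ℓ) ∧
    ∃ (K : ℝ≥0) (C₃ C₄ : ℝ), ∀ (N : ℕ) (x : Params ℓ), numParams ℓ ≤ N →
      (∀ j, ‖node x j‖ = 1) → 0 < separation x →
      (∀ j, coeff x j ((ℓ j : ℤ) - 1) ≠ 0) →
      (K : ℝ≥0∞) * (separation x)⁻¹ < (N : ℝ≥0∞) →
      (∀ (j : Fin 𝒦) (i : Fin (ℓ j)),
        condNumber N x (coeffIdx j i) ≤
          C₃ * (1 + ‖coeff x j ((i : ℤ) - 1)‖ / ‖coeff x j ((ℓ j : ℤ) - 1)‖) *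
            (1 / (N : ℝ) ^ (i : ℕ))) ∧
      (∀ j : Fin 𝒦,
        condNumber N x (nodeIdx j) ≤
          C₄ * (1 / ‖coeff x j ((ℓ j : ℤ) - 1)‖) * (1 / (N : ℝ) ^ ℓ j)) := by
  refine ⟨fun N x hN hx hsep htop => jacobian_rank hN hx hsep htop, ?_⟩
  obtain ⟨K, C, hC, hb⟩ := exists_vandermondeCoord_bound ℓ
  refine ⟨K, C, C, fun N x hN hx hsep htop hNK => ?_⟩
  -- The existence of `j` forces `𝒦 ≥ 1`, hence `N ≥ 1`; without nodes `N = 0` is possible.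
  have hN1 : ∀ j : Fin 𝒦, (1 : ℝ) ≤ N := by
    intro j
    have h1 : 𝒦 ≤ N := le_trans (Nat.le_add_left _ _) hN
    have h2 := j.pos
    exact_mod_cast h2.trans_le h1
  have hnode : ∀ (j : Fin 𝒦) (w : Params ℓ), √N * ‖w (nodeIdx j)‖ ≤
      C * (1 / ‖coeff x j ((ℓ j : ℤ) - 1)‖) * (1 / (N : ℝ) ^ ℓ j) *
        √(∑ k, ‖(jacobian N x *ᵥ w) k‖ ^ 2) := by
    intro j w
    have h1 := hb N x hN hx hsep hNK w (nodeIdx j)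
    have ha : 0 < ‖coeff x j ((ℓ j : ℤ) - 1)‖ := norm_pos_iff.2 (htop j)
    have hNp : 0 < (N : ℝ) ^ ℓ j := pow_pos (one_pos.trans_le (hN1 j)) _
    rw [vandermondeCoord_nodeIdx, norm_mul, norm_mul, norm_inv, hx, inv_one, one_mul] at h1
    have h2 : ((nodeIdx j : ParamIdx ℓ).2 : ℕ) = ℓ j := rfl
    rw [h2] at h1
    have h3 : C * (1 / ‖coeff x j ((ℓ j : ℤ) - 1)‖) * (1 / (N : ℝ) ^ ℓ j) *
        √(∑ k, ‖(jacobian N x *ᵥ w) k‖ ^ 2) = C * √(∑ k, ‖(jacobian N x *ᵥ w) k‖ ^ 2) /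
          ((N : ℝ) ^ ℓ j * ‖coeff x j ((ℓ j : ℤ) - 1)‖) := by
      field_simp
    rw [h3, le_div_iff₀ (by positivity)]
    exact le_trans (le_of_eq (by ring)) h1
  refine ⟨fun j i => condNumber_le_of_forall x _ (by positivity) fun w => ?_,
    fun j => condNumber_le_of_forall x _ (by positivity) (hnode j)⟩
  have h1 := hb N x hN hx hsep hNK w (coeffIdx j i)
  have h2 : ((coeffIdx j i : ParamIdx ℓ).2 : ℕ) = i := rfl
  rw [h2] at h1
  set Q := √(∑ k, ‖(jacobian N x *ᵥ w) k‖ ^ 2)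
  set A := ‖coeff x j ((i : ℤ) - 1)‖
  set a := ‖coeff x j ((ℓ j : ℤ) - 1)‖
  set c := ‖vandermondeCoord x w (coeffIdx j i)‖ with hc
  have hNp : 0 < (N : ℝ) ^ (i : ℕ) := pow_pos (one_pos.trans_le (hN1 j)) _
  have h3 : √N * c ≤ C * Q * (1 / (N : ℝ) ^ (i : ℕ)) := by
    rw [mul_one_div, le_div_iff₀ hNp]
    exact le_trans (le_of_eq (by ring)) h1
  -- The node estimate is weakened from `N^(-ℓ_j)` to `N^(-i)` so as to combine with the bound for
  -- `c`.
  have h4 : √N * ‖w (nodeIdx j)‖ ≤ C * (1 / a) * (1 / (N : ℝ) ^ (i : ℕ)) * Q := by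
    refine (hnode j w).trans ?_
    gcongr
    · exact hN1 j
    · exact i.2.le
  have h5 : ‖w (coeffIdx j i)‖ ≤ c + A * ‖w (nodeIdx j)‖ := by
    have h6 : w (coeffIdx j i) = vandermondeCoord x w (coeffIdx j i) -
        (node x j)⁻¹ * coeff x j ((i : ℤ) - 1) * w (nodeIdx j) := by
      rw [vandermondeCoord_coeffIdx, add_sub_cancel_right]
    rw [h6]
    refine (norm_sub_le _ _).trans (le_of_eq ?_)
    rw [norm_mul, norm_mul, norm_inv, hx, inv_one, one_mul]
  calc √N * ‖w (coeffIdx j i)‖ ≤ √N * (c + A * ‖w (nodeIdx j)‖) := by gcongr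
    _ = √N * c + A * (√N * ‖w (nodeIdx j)‖) := by ring
    _ ≤ C * Q * (1 / (N : ℝ) ^ (i : ℕ)) +
        A * (C * (1 / a) * (1 / (N : ℝ) ^ (i : ℕ)) * Q) := by gcongr
    _ = C * (1 + A / a) * (1 / (N : ℝ) ^ (i : ℕ)) * Q := by ring
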